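/- Let $n\ge 1$, let $T$ be the set of transpositions in the symmetric group $S_n$, let $\ell_T(\pi)$ be the minimal number of factors in an expression of $\pi\in S_n$ as a product of transpositions, and let $c=(1,2,\dots,n)$. Products of permutations are taken from right to left. Let $NC(n)=\{\pi\in S_n:\ell_T(\pi)+\ell_T(\pi^{-1}c)=\ell_T(c)\}$, ordered by $\pi\le\sigma\iff\ell_T(\pi)+\ell_T(\pi^{-1}\sigma)=\ell_T(\sigma)$, be the lattice of noncrossing partitions, and let $F_n$ be the set of its maximal chains. A maximal chain $\mathrm{id}=\pi_0<\pi_1<\dots<\pi_{n-1}=c$ is identified with the factorization $(t_1,\dots,t_{n-1})$ of $c$ into transpositions for which $\pi_j=t_1\cdots t_j$ for all $j$. Let $G_T(n)$ be the graph with vertex set $F_n$ in which two chains are adjacent if they differ in exactly one element, and let $\mathrm{Weak}(F_n)$ be the set $F_n$ with the relation: $u\le v$ if $u$ lies on a geodesic of $G_T(n)$ from $e=((1,2),(2,3),\dots,(n-1,n))$ to $v$. For $w=(t_1,\dots,t_{n-1})\in F_n$ put $\sigma_j=t_jt_{j+1}\cdots t_{n-1}$ for $1\le j\le n-1$, and $\sigma_n=\mathrm{id}$.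 For each $1\le j\le n-1$ there is exactly one $i\in\{1,\dots,n-1\}$ with $\sigma_j(i)>\sigma_{j+1}(i)$; put $\phi(w)(j)=i$. This defines a map $\phi:F_n\to S_{n-1}$. The weak order on $S_{n-1}$ is the partial order in which $\sigma$ covers $\pi$ if and only if $\sigma=\pi s_j$ for some adjacent transposition $s_j=(j,j+1)$, $1\le j\le n-2$, and $\sigma$ has exactly one inversion more than $\pi$. Then $\mathrm{Weak}(F_n)$ is a partially ordered set with least element $e$, and for every maximal element $w_0$ of $\mathrm{Weak}(F_n)$ the restriction of $\phi$ to the (maximal) interval $[e,w_0]$ is an isomorphism of posets from $[e,w_0]$ onto $S_{n-1}$ with the weak order. -/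

import Mathlib

open Equiv

/-! ### Absolute length and noncrossing partitions -/

/-- The absolute length `ℓ_T(π)`: the minimal number of factors in an expression of `π`
as a product of transpositions. -/
noncomputable def absLength {n : ℕ} (π : Perm (Fin n)) : ℕ :=
  sInf {k | ∃ l : List (Perm (Fin n)), l.length = k ∧ (∀ t ∈ l, t.IsSwap) ∧ l.prod = π}

theorem exists_absLength_list {n : ℕ} (π : Perm (Fin n)) :
    ∃ l : List (Perm (Fin n)), l.length = absLength π ∧ (∀ t ∈ l, t.IsSwap) ∧ l.prod = π := by
  have h : {k | ∃ l : List (Perm (Fin n)), l.length = k ∧ (∀ t ∈ l, t.IsSwap) ∧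
      l.prod = π}.Nonempty :=
    ⟨_, (Perm.swapFactors π).1, rfl, (Perm.swapFactors π).2.2, (Perm.swapFactors π).2.1⟩
  exact Nat.sInf_mem h

theorem absLength_prod_le {n : ℕ} (l : List (Perm (Fin n))) (h : ∀ t ∈ l, t.IsSwap) :
    absLength l.prod ≤ l.length :=
  Nat.sInf_le ⟨l, rfl, h, rfl⟩

theorem absLength_one {n : ℕ} : absLength (1 : Perm (Fin n)) = 0 :=
  Nat.le_zero.1 (absLength_prod_le (n := n) [] (by simp))

theorem eq_one_of_absLength {n : ℕ} {π : Perm (Fin n)} (h : absLength π = 0) : π = 1 := by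
  obtain ⟨l, hl, -, rfl⟩ := exists_absLength_list π
  rw [h, List.length_eq_zero_iff] at hl
  simp [hl]

theorem isSwap_of_absLength {n : ℕ} {π : Perm (Fin n)} (h : absLength π = 1) : π.IsSwap := by
  obtain ⟨l, hl, hs, rfl⟩ := exists_absLength_list π
  rw [h, List.length_eq_one_iff] at hl
  obtain ⟨a, rfl⟩ := hl
  simpa using hs

theorem absLength_mul_le {n : ℕ} (π σ : Perm (Fin n)) :
    absLength (π * σ) ≤ absLength π + absLength σ := by
  obtain ⟨l, hl, hs, rfl⟩ := exists_absLength_list π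
  obtain ⟨l', hl', hs', rfl⟩ := exists_absLength_list σ
  rw [← hl, ← hl', ← List.length_append, ← List.prod_append]
  refine absLength_prod_le _ fun t ht => ?_
  rcases List.mem_append.1 ht with h | h
  exacts [hs t h, hs' t h]

/-- The noncrossing partition lattice `NC(n)`, with respect to the `n`-cycle
`c = (1, 2, …, n)` (here `finRotate n`). -/
@[ext]
structure NC (n : ℕ) where
  /-- The underlying permutation. -/
  val : Perm (Fin n)
  property : absLength val + absLength (val⁻¹ * finRotate n) = absLength (finRotate n)

theorem NC.val_injective {n : ℕ} : Function.Injective (NC.val (n := n)) := fun _ _ => NC.ext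

instance (n : ℕ) : PartialOrder (NC n) where
  le π σ := absLength π.1 + absLength (π.1⁻¹ * σ.1) = absLength σ.1
  le_refl π := by simp [absLength_one]
  le_trans π σ τ h₁ h₂ := by
    have h₃ := absLength_mul_le (π.1⁻¹ * σ.1) (σ.1⁻¹ * τ.1)
    have h₄ := absLength_mul_le π.1 (π.1⁻¹ * τ.1)
    simp only [mul_assoc, mul_inv_cancel_left] at h₃ h₄
    lia
  le_antisymm π σ h₁ h₂ := by
    have h₃ : π.1⁻¹ * σ.1 = 1 := eq_one_of_absLength (by lia)
    exact NC.ext (inv_mul_eq_one.1 h₃)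

theorem NC.le_def {n : ℕ} (π σ : NC n) :
    π ≤ σ ↔ absLength π.1 + absLength (π.1⁻¹ * σ.1) = absLength σ.1 := Iff.rfl

/-! ### Factors of the long cycle -/

theorem ascent_unique {n : ℕ} {t : Perm (Fin n)} (ht : t.IsSwap) {x y : Fin n}
    (hx : x < t x) (hy : y < t y) : x = y := by
  obtain ⟨a, b, -, rfl⟩ := ht
  simp only [swap_apply_def] at hx hy
  grind

theorem exists_ascent {n : ℕ} (l : List (Perm (Fin n))) (i : Fin n) (h : i < l.prod i) :
    ∃ j < l.length, (l.drop (j + 1)).prod i < (l.drop j).prod i := by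
  induction l with
  | nil => simp at h
  | cons t l ih =>
    by_cases h' : i < l.prod i
    · obtain ⟨j, hj, hlt⟩ := ih h'
      exact ⟨j + 1, by simpa using hj, by simpa using hlt⟩
    · exact ⟨0, by simp, by simpa using lt_of_le_of_lt (not_lt.1 h') h⟩

theorem drop_ascent_unique {n : ℕ} {l : List (Perm (Fin n))} (hs : ∀ t ∈ l, t.IsSwap)
    {j : ℕ} (hj : j < l.length) {x y : Fin n}
    (hx : (l.drop (j + 1)).prod x < (l.drop j).prod x)
    (hy : (l.drop (j + 1)).prod y < (l.drop j).prod y) : x = y := by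
  rw [List.drop_eq_getElem_cons hj, List.prod_cons, Perm.mul_apply] at hx hy
  exact (Equiv.injective _) (ascent_unique (hs _ (List.getElem_mem hj)) hx hy)

theorem castSucc_lt_finRotate {m : ℕ} (i : Fin m) :
    i.castSucc < finRotate (m + 1) i.castSucc := by
  rw [lt_finRotate_iff_ne_last]
  exact (Fin.castSucc_lt_last i).ne

theorem le_length_of_prod {m : ℕ} {l : List (Perm (Fin (m + 1)))} (hs : ∀ t ∈ l, t.IsSwap)
    (hp : l.prod = finRotate (m + 1)) : m ≤ l.length := by
  have h (i : Fin m) := exists_ascent l i.castSucc (by rw [hp]; exact castSucc_lt_finRotate i)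
  choose f hf hlt using h
  have hinj : Function.Injective (fun i => (⟨f i, hf i⟩ : Fin l.length)) := by
    intro i i' hii
    have hii : f i = f i' := by simpa using hii
    have h' := hlt i'
    rw [← hii] at h'
    exact Fin.castSucc_injective _ (drop_ascent_unique hs (hf i) (hlt i) h')
  simpa using Fintype.card_le_of_injective _ hinj

/-- The word `((1,2), (2,3), …, (n-1,n))`, for `n = m + 1`. -/
def simpleWord (m : ℕ) (i : Fin m) : Perm (Fin (m + 1)) := swap i.castSucc i.succ

theorem simpleWord_isSwap {m : ℕ} (i : Fin m) : (simpleWord m i).IsSwap :=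
  ⟨_, _, (Fin.castSucc_lt_succ).ne, rfl⟩

theorem simpleWord_drop {m : ℕ} (d : ℕ) : ∀ k, k + d = m → ∀ x : Fin (m + 1),
    (((List.ofFn (simpleWord m)).drop k).prod x : ℕ) =
      if (x : ℕ) < k then (x : ℕ) else if (x : ℕ) < m then x + 1 else k := by
  induction d with
  | zero =>
    intro k hk x
    rw [List.drop_of_length_le (by simp; lia)]
    simp only [List.prod_nil, Perm.coe_one, id_eq]
    grind
  | succ d ih =>
    intro k hk x
    rw [List.drop_eq_getElem_cons (by simp; lia), List.prod_cons, Perm.mul_apply]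
    have h := ih (k + 1) (by lia) x
    set y := (List.drop (k + 1) (List.ofFn (simpleWord m))).prod x
    simp only [List.getElem_ofFn, simpleWord, swap_apply_def, Fin.ext_iff, apply_ite Fin.val,
      Fin.val_castSucc, Fin.val_succ]
    grind

theorem simpleWord_prod (m : ℕ) : (List.ofFn (simpleWord m)).prod = finRotate (m + 1) := by
  ext x
  have h := simpleWord_drop m 0 (by simp) x
  rw [List.drop_zero] at h
  rw [h, coe_finRotate]
  have := x.2
  by_cases hx : x = Fin.last m
  · subst hx; simp
  · have : (x : ℕ) ≠ m := fun h => hx (Fin.ext h)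
    simp [hx]; lia

theorem absLength_finRotate (m : ℕ) : absLength (finRotate (m + 1)) = m := by
  refine le_antisymm ?_ ?_
  · have h := absLength_prod_le (List.ofFn (simpleWord m))
      (by simpa [List.forall_mem_ofFn_iff] using fun i => simpleWord_isSwap i)
    rwa [simpleWord_prod, List.length_ofFn] at h
  · obtain ⟨l, hl, hs, hp⟩ := exists_absLength_list (finRotate (m + 1))
    exact hl ▸ le_length_of_prod hs hp

/-! ### Maximal chains -/

/-- `F_n`: the set of all maximal chains in `NC(n)`. (This is a type of its own, so that it
does not carry the inclusion order of `Flag`.) -/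
def MaxChain (n : ℕ) : Type := Flag (NC n)

/-- The set of elements of a maximal chain. -/
def MaxChain.elems {n : ℕ} (C : MaxChain n) : Set (NC n) := Flag.carrier C

theorem MaxChain.mem_elems {n : ℕ} (C : MaxChain n) {x : NC n}
    (h : ∀ y ∈ C.elems, x ≤ y ∨ y ≤ x) : x ∈ C.elems :=
  Flag.mem_iff_forall_le_or_ge.2 h

theorem MaxChain.le_or_le {n : ℕ} (C : MaxChain n) {x y : NC n}
    (hx : x ∈ C.elems) (hy : y ∈ C.elems) : x ≤ y ∨ y ≤ x :=
  Flag.le_or_le C hx hy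

theorem partialProd_aux {m : ℕ} {t : Fin m → Perm (Fin (m + 1))} (ht : ∀ i, (t i).IsSwap)
    (hp : (List.ofFn t).prod = finRotate (m + 1)) (a b : ℕ) (hab : a ≤ b) (hb : b ≤ m) :
    absLength ((((List.ofFn t).take a).prod)⁻¹ * ((List.ofFn t).take b).prod) = b - a := by
  have key : ∀ l' : List (Perm (Fin (m + 1))), (∀ x ∈ l', x ∈ List.ofFn t) →
      absLength l'.prod ≤ l'.length := fun l' h => absLength_prod_le _ fun x hx => by
    obtain ⟨i, rfl⟩ := List.mem_ofFn.1 (h x hx)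
    exact ht i
  set l := List.ofFn t with hl
  have hlen : l.length = m := by simp [hl]
  have e₁ : (l.take a).prod * ((l.take b).drop a).prod = (l.take b).prod := by
    rw [← List.prod_append]
    congr 1
    have h := List.take_append_drop a (l.take b)
    rwa [List.take_take, min_eq_left hab] at h
  have e₂ : (l.take b).prod * (l.drop b).prod = l.prod := by
    rw [← List.prod_append, List.take_append_drop]
  have h₁ := key (l.take a) fun x hx => List.mem_of_mem_take hx
  have h₂ := key ((l.take b).drop a) fun x hx => List.mem_of_mem_take (List.mem_of_mem_drop hx)
  have h₃ := key (l.drop b) fun x hx => List.mem_of_mem_drop hx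
  have h₄ := absLength_mul_le (l.take a).prod ((l.take b).drop a).prod
  have h₅ := absLength_mul_le (l.take b).prod (l.drop b).prod
  rw [e₁] at h₄
  rw [e₂, hp, absLength_finRotate] at h₅
  simp only [List.length_take, List.length_drop, hlen] at h₁ h₂ h₃
  rw [← e₁, inv_mul_cancel_left]
  lia

theorem absLength_take {m : ℕ} {t : Fin m → Perm (Fin (m + 1))} (ht : ∀ i, (t i).IsSwap)
    (hp : (List.ofFn t).prod = finRotate (m + 1)) (k : ℕ) (hk : k ≤ m) :
    absLength ((List.ofFn t).take k).prod = k := by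
  simpa using partialProd_aux ht hp 0 k (by simp) hk

theorem take_mem_NC {m : ℕ} {t : Fin m → Perm (Fin (m + 1))} (ht : ∀ i, (t i).IsSwap)
    (hp : (List.ofFn t).prod = finRotate (m + 1)) (k : ℕ) (hk : k ≤ m) :
    absLength ((List.ofFn t).take k).prod +
      absLength (((List.ofFn t).take k).prod⁻¹ * finRotate (m + 1)) =
      absLength (finRotate (m + 1)) := by
  have h := partialProd_aux ht hp k m hk le_rfl
  rw [List.take_of_length_le (i := m) (by simp), hp] at h
  rw [absLength_take ht hp k hk, h, absLength_finRotate]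
  lia

/-- The maximal chain `id < t_1 < t_1 t_2 < ⋯ < t_1 ⋯ t_m = c` that corresponds to a
factorization of `c = (1, 2, …, m+1)` into `m` transpositions. -/
def MaxChain.ofWord {m : ℕ} (t : Fin m → Perm (Fin (m + 1))) (ht : ∀ i, (t i).IsSwap)
    (hp : (List.ofFn t).prod = finRotate (m + 1)) : MaxChain (m + 1) :=
  Flag.ofIsMaxChain
    {x | ∃ k ≤ m, x.1 = ((List.ofFn t).take k).prod} <| by
      have hle (x y : NC (m + 1)) (a b : ℕ) (hab : a ≤ b) (hb : b ≤ m)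
          (hx : x.1 = ((List.ofFn t).take a).prod) (hy : y.1 = ((List.ofFn t).take b).prod) :
          x ≤ y := by
        rw [NC.le_def, hx, hy, partialProd_aux ht hp a b hab hb,
          absLength_take ht hp a (hab.trans hb), absLength_take ht hp b hb]
        lia
      refine ⟨?_, ?_⟩
      · rintro x ⟨a, ha, hx⟩ y ⟨b, hb, hy⟩ -
        rcases le_total a b with hab | hab
        · exact Or.inl (hle x y a b hab hb hx hy)
        · exact Or.inr (hle y x b a hab ha hy hx)
      · intro s hs hsub
        refine subset_antisymm hsub fun x hx => ?_
        have hxm : absLength x.1 ≤ m := by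
          have := x.property
          rw [absLength_finRotate m] at this
          lia
        refine ⟨_, hxm, ?_⟩
        set y : NC (m + 1) := ⟨_, take_mem_NC ht hp _ hxm⟩ with hy
        have hys : y ∈ s := hsub ⟨_, hxm, rfl⟩
        have hyl : absLength y.1 = absLength x.1 := absLength_take ht hp _ hxm
        suffices x = y from congrArg NC.val this
        rcases hs.total hx hys with h | h
        · rw [NC.le_def] at h
          exact NC.ext (inv_mul_eq_one.1 (eq_one_of_absLength (by lia)))
        · rw [NC.le_def] at h
          exact (NC.ext (inv_mul_eq_one.1 (eq_one_of_absLength (by lia)))).symm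

/-- The maximal chain `e` corresponding to the word `((1,2), (2,3), …, (n-1,n))`,
for `n = m + 1`. -/
def MaxChain.e (m : ℕ) : MaxChain (m + 1) :=
  MaxChain.ofWord (simpleWord m) simpleWord_isSwap (simpleWord_prod m)

/-- Each maximal chain of `NC(m+1)` has exactly one element of each rank `k ≤ m`. -/
theorem MaxChain.existsUnique_rank {m : ℕ} (C : MaxChain (m + 1)) (k : Fin (m + 1)) :
    ∃! x, x ∈ C.elems ∧ absLength x.1 = k := by
  have hmono (x y : NC (m + 1)) (h : x ≤ y) : absLength x.1 ≤ absLength y.1 := by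
    rw [NC.le_def] at h; lia
  refine existsUnique_of_exists_of_unique ?_ ?_
  swap
  · rintro x y ⟨hx, hxk⟩ ⟨hy, hyk⟩
    rcases C.le_or_le hx hy with h | h
    · rw [NC.le_def] at h
      exact NC.ext (inv_mul_eq_one.1 (eq_one_of_absLength (by lia)))
    · rw [NC.le_def] at h
      exact (NC.ext (inv_mul_eq_one.1 (eq_one_of_absLength (by lia)))).symm
  have : Finite (NC (m + 1)) := Finite.of_injective _ NC.val_injective
  let bot : NC (m + 1) := ⟨1, by simp [absLength_one]⟩
  let top : NC (m + 1) := ⟨finRotate (m + 1), by simp [absLength_one]⟩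
  have hbot : bot ∈ C.elems := C.mem_elems fun y _ => Or.inl (by
    rw [NC.le_def]
    simp [bot, absLength_one])
  have htop : top ∈ C.elems := C.mem_elems fun y _ => Or.inr y.2
  obtain ⟨x, ⟨hx, hxk⟩, hxmax⟩ := Set.exists_max_image
    {x | x ∈ C.elems ∧ absLength x.1 ≤ k} (fun x => absLength x.1) (Set.toFinite _)
    ⟨bot, hbot, by simp [bot, absLength_one]⟩
  by_contra hne
  have hxlt : absLength x.1 < k := lt_of_le_of_ne hxk fun h => hne ⟨x, hx, h⟩
  have htopl : absLength top.1 = m := absLength_finRotate m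
  obtain ⟨y, ⟨hy, hyk⟩, hymin⟩ := Set.exists_min_image
    {y | y ∈ C.elems ∧ (k : ℕ) < absLength y.1} (fun x => absLength x.1) (Set.toFinite _)
    ⟨top, htop, lt_of_le_of_ne (by rw [htopl]; exact Nat.lt_succ_iff.1 k.2)
      fun h => hne ⟨top, htop, h.symm⟩⟩
  have hxy : x ≤ y := (C.le_or_le hx hy).resolve_right fun h => by
    have := hmono _ _ h
    lia
  rw [NC.le_def] at hxy
  obtain ⟨l, hl, hs, hp⟩ := exists_absLength_list (x.1⁻¹ * y.1)
  cases l with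
  | nil => simp at hl; lia
  | cons t l =>
    have h₁ : absLength t ≤ 1 := by
      simpa using absLength_prod_le [t] (by simpa using hs t (by simp))
    have h₂ := absLength_prod_le l fun u hu => hs u (by simp [hu])
    rw [List.prod_cons] at hp
    rw [List.length_cons] at hl
    have hyz : (x.1 * t)⁻¹ * y.1 = l.prod := by
      rw [mul_inv_rev, mul_assoc, ← hp, inv_mul_cancel_left]
    have h₃ := absLength_mul_le x.1 t
    have h₄ := absLength_mul_le (x.1 * t) l.prod
    rw [← hyz, mul_inv_cancel_left, hyz] at h₄
    have hy2 := y.2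
    have h₅ := absLength_mul_le l.prod (y.1⁻¹ * finRotate (m + 1))
    rw [← hyz, mul_assoc, mul_inv_cancel_left, hyz] at h₅
    have h₆ := absLength_mul_le (x.1 * t) ((x.1 * t)⁻¹ * finRotate (m + 1))
    rw [mul_inv_cancel_left] at h₆
    let z : NC (m + 1) := ⟨x.1 * t, by lia⟩
    have hz1 : z.1 = x.1 * t := rfl
    have hxz : x ≤ z := by
      have h₇ := absLength_mul_le x.1 (x.1⁻¹ * z.1)
      rw [mul_inv_cancel_left] at h₇
      rw [NC.le_def]
      simp only [hz1, inv_mul_cancel_left] at h₇ ⊢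
      lia
    have hzy : z ≤ y := by
      rw [NC.le_def, hz1, hyz]
      lia
    have hz : z ∈ C.elems := C.mem_elems fun u hu => by
      by_cases huk : absLength u.1 ≤ k
      · right
        refine le_trans ?_ hxz
        rcases C.le_or_le hu hx with h | h
        · exact h
        · have h₈ := hxmax u ⟨hu, huk⟩
          have h₉ := hmono _ _ h
          rw [NC.le_def] at h
          exact (NC.ext (inv_mul_eq_one.1 (eq_one_of_absLength (by lia)))).symm.le
      · left
        refine hzy.trans ?_
        rcases C.le_or_le hy hu with h | h
        · exact h
        · have h₈ := hymin u ⟨hu, not_le.1 huk⟩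
          have h₉ := hmono _ _ h
          rw [NC.le_def] at h
          exact (NC.ext (inv_mul_eq_one.1 (eq_one_of_absLength (by lia)))).symm.le
    have h₈ := hxmax z ⟨hz, by rw [hz1]; lia⟩
    simp only [hz1] at h₈
    lia

/-- The element of rank `k` of a maximal chain. -/
noncomputable def MaxChain.elt {m : ℕ} (C : MaxChain (m + 1)) (k : Fin (m + 1)) : NC (m + 1) :=
  (C.existsUnique_rank k).choose

theorem MaxChain.elt_spec {m : ℕ} (C : MaxChain (m + 1)) (k : Fin (m + 1)) :
    C.elt k ∈ C.elems ∧ absLength (C.elt k).1 = k :=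
  (C.existsUnique_rank k).choose_spec.1

/-- The word `(t_1, …, t_m)` of a maximal chain `id = π_0 < π_1 < ⋯ < π_m = c` of `NC(m+1)`:
the transpositions with `π_j = π_{j-1} t_j`. (The indices of `word` start with `0`.) -/
noncomputable def MaxChain.word {m : ℕ} (C : MaxChain (m + 1)) (j : Fin m) :
    Perm (Fin (m + 1)) :=
  (C.elt j.castSucc).1⁻¹ * (C.elt j.succ).1

theorem MaxChain.word_isSwap {m : ℕ} (C : MaxChain (m + 1)) (j : Fin m) :
    (C.word j).IsSwap := by
  obtain ⟨h₁, h₁'⟩ := C.elt_spec j.castSucc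
  obtain ⟨h₂, h₂'⟩ := C.elt_spec j.succ
  simp only [Fin.val_castSucc, Fin.val_succ] at h₁' h₂'
  rcases C.le_or_le h₁ h₂ with h | h
  · rw [NC.le_def] at h
    exact isSwap_of_absLength (by rw [MaxChain.word]; lia)
  · rw [NC.le_def] at h
    lia

theorem MaxChain.word_prod {m : ℕ} (C : MaxChain (m + 1)) :
    (List.ofFn C.word).prod = finRotate (m + 1) := by
  have h : ∀ k (hk : k < m + 1), ((List.ofFn C.word).take k).prod = (C.elt ⟨k, hk⟩).1 := by
    intro k
    induction k with
    | zero =>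
      intro hk
      have h := (C.elt_spec ⟨0, hk⟩).2
      rw [List.take_zero, List.prod_nil, eq_one_of_absLength h]
    | succ k ih =>
      intro hk
      rw [List.prod_take_succ _ _ (by simpa using hk), ih (by lia), List.getElem_ofFn]
      exact mul_inv_cancel_left _ _
  have h₁ := h m (by lia)
  rw [List.take_of_length_le (by simp)] at h₁
  rw [h₁]
  have h₂ := (C.elt ⟨m, by lia⟩).2
  have h₃ := (C.elt_spec ⟨m, by lia⟩).2
  rw [h₃, absLength_finRotate m] at h₂
  exact inv_mul_eq_one.1 (eq_one_of_absLength (by simpa using h₂))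

/-! ### The Hurwitz graph and the weak order on maximal chains -/

/-- The Hurwitz graph `G_T(n)`: its vertices are the maximal chains of `NC(n)`, and two chains
are adjacent if they differ in exactly one element. -/
def hurwitzGraph (n : ℕ) : SimpleGraph (MaxChain n) where
  Adj C D := (C.elems \ D.elems).ncard = 1 ∧ (D.elems \ C.elems).ncard = 1
  symm := ⟨fun _ _ h => ⟨h.2, h.1⟩⟩
  loopless := ⟨fun C h => by simp at h⟩

/-- The weak order `Weak(F_n)`: `u ≤ v` if `u` lies on a geodesic of the Hurwitz graph
from `e` to `v`. -/
instance (m : ℕ) : LE (MaxChain (m + 1)) where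
  le u v := ∃ p : (hurwitzGraph (m + 1)).Walk (MaxChain.e m) v,
    p.length = (hurwitzGraph (m + 1)).dist (MaxChain.e m) v ∧ u ∈ p.support

/-! ### The map `φ` -/

/-- The partial products `σ_j = t_j t_{j+1} ⋯ t_m` of the word of a maximal chain
(with `j` starting from `0`, so that `sigma 0 = c` and `sigma m = id`). -/
noncomputable def MaxChain.sigma {m : ℕ} (C : MaxChain (m + 1)) (j : ℕ) : Perm (Fin (m + 1)) :=
  ((List.ofFn C.word).drop j).prod

/-- For each `j` there is exactly one `i ≠ n` with `σ_j(i) > σ_{j+1}(i)`, and the map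
sending `j` to this `i` is a bijection. -/
theorem MaxChain.phi_aux {m : ℕ} (C : MaxChain (m + 1)) :
    ∃ f : Perm (Fin m), ∀ j i : Fin m,
      C.sigma (j + 1) i.castSucc < C.sigma j i.castSucc ↔ f j = i := by
  have hs : ∀ t ∈ List.ofFn C.word, t.IsSwap := fun t ht => by
    obtain ⟨i, rfl⟩ := List.mem_ofFn.1 ht
    exact C.word_isSwap i
  have h (i : Fin m) : ∃ j : Fin m, C.sigma (j + 1) i.castSucc < C.sigma j i.castSucc := by
    obtain ⟨j, hj, h⟩ := exists_ascent (List.ofFn C.word) i.castSucc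
      (by rw [C.word_prod]; exact castSucc_lt_finRotate i)
    exact ⟨⟨j, by simpa using hj⟩, h⟩
  have huniq (j i i' : Fin m) (h : C.sigma (j + 1) i.castSucc < C.sigma j i.castSucc)
      (h' : C.sigma (j + 1) i'.castSucc < C.sigma j i'.castSucc) : i = i' :=
    Fin.castSucc_injective _ (drop_ascent_unique hs (by simp) h h')
  choose g hg using h
  have hinj : Function.Injective g := fun i i' hii =>
    huniq (g i) i i' (hg i) (by rw [hii]; exact hg i')
  let e := Equiv.ofBijective g hinj.bijective_of_finite
  refine ⟨e.symm, fun j i => ⟨fun h => ?_, ?_⟩⟩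
  · have h' := hg (e.symm j)
    rw [show g (e.symm j) = j from e.apply_symm_apply j] at h'
    exact huniq j _ _ h' h
  · rintro rfl
    have h' := hg (e.symm j)
    rwa [show g (e.symm j) = j from e.apply_symm_apply j] at h'

/-- The map `φ : F_n → S_{n-1}` (with `n = m + 1`): `φ(w)(j)` is the unique `i ∈ {1, …, n-1}`
with `σ_j(i) > σ_{j+1}(i)`. -/
noncomputable def MaxChain.phi {m : ℕ} (C : MaxChain (m + 1)) : Perm (Fin m) :=
  C.phi_aux.choose

theorem MaxChain.phi_apply_eq_iff {m : ℕ} (C : MaxChain (m + 1)) (j i : Fin m) :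
    C.phi j = i ↔ C.sigma (j + 1) i.castSucc < C.sigma j i.castSucc :=
  (C.phi_aux.choose_spec j i).symm

/-! ### The weak order on the symmetric group -/

/-- The inversion number of a permutation. -/
def invNumber {m : ℕ} (π : Perm (Fin m)) : ℕ :=
  (Finset.univ.filter fun p : Fin m × Fin m => p.1 < p.2 ∧ π p.2 < π p.1).card

/-- `σ = π s_j` for an adjacent transposition `s_j = (j, j+1)`, with one inversion more
than `π`. -/
def WeakCover {m : ℕ} (π σ : Perm (Fin m)) : Prop :=
  ∃ i j : Fin m, (i : ℕ) + 1 = j ∧ σ = π * swap i j ∧ invNumber σ = invNumber π + 1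

/-- The symmetric group `S_m` with its (right) weak order. -/
def WeakPerm (m : ℕ) : Type := Perm (Fin m)

/-- A permutation, seen as an element of the poset `WeakPerm m` (the identity map). -/
def WeakPerm.of {m : ℕ} : Perm (Fin m) ≃ WeakPerm m := Equiv.refl _

instance (m : ℕ) : PartialOrder (WeakPerm m) where
  le π σ := Relation.ReflTransGen (WeakCover (m := m)) (WeakPerm.of.symm π) (WeakPerm.of.symm σ)
  le_refl _ := Relation.ReflTransGen.refl
  le_trans _ _ _ := Relation.ReflTransGen.trans
  le_antisymm π σ h₁ h₂ := by
    have hmono {π σ : Perm (Fin m)} (h : Relation.ReflTransGen WeakCover π σ) :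
        π = σ ∨ invNumber π < invNumber σ := by
      induction h with
      | refl => exact Or.inl rfl
      | tail _ hc ih =>
        obtain ⟨i, j, -, -, hc⟩ := hc
        right
        rcases ih with rfl | ih <;> lia
    rcases hmono h₁ with h | h
    · exact h
    rcases hmono h₂ with h' | h'
    · exact h'.symm
    · lia

/-! ### Inversions and the weak order -/

/-! A chain is encoded by its suffix products `sigma s`, and changing one element of the chain
changes one `sigma j`. Such a change either fixes `phi` or swaps its entries at positions `j - 1`
and `j`, and a change of the second kind always exists (`exists_flip`). Hence each edge of the
Hurwitz graph changes the inversion number of `phi` by at most one. Removing descents of `phi` leads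
from any chain to one with `phi = 1`, which can only be `e`. So the distance from `e` is the
inversion number (`dist_e`), and the order on chains is generated by the flips that create a descent
(`le_iff`). This gives the partial order and the least element, makes `phi` monotone, and lets every
weak-order relation below `phi v` be lifted to chains below `v` (`exists_reflTransGen`).

What remains is injectivity of `phi` below a fixed chain. It rests on a rigidity statement,
`ext_of_ascent`: two chains with the same `phi` can differ only if some differing `sigma j` sits at
a place where `phi` does not ascend. Thus flipping a descent away has a unique result, and the
square and hexagon relations of the weak order close up on chains. Two lower covers of a chain
therefore have a common lower bound lying over the meet of their images (`exists_meet`), and a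
diamond-lemma induction gives `eq_of_phi_eq`. A maximal chain has no ascent in `phi`, so its image
is the longest permutation and lifting yields surjectivity. -/

/-- The inversions of `π`, as pairs of values. -/
def valueInv {m : ℕ} (π : Perm (Fin m)) : Finset (Fin m × Fin m) :=
  Finset.univ.filter fun p => p.1 < p.2 ∧ π.symm p.2 < π.symm p.1

theorem mem_valueInv {m : ℕ} {π : Perm (Fin m)} {x y : Fin m} :
    (x, y) ∈ valueInv π ↔ x < y ∧ π.symm y < π.symm x := by
  simp [valueInv]

theorem card_valueInv {m : ℕ} (π : Perm (Fin m)) : (valueInv π).card = invNumber π := by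
  refine Finset.card_bij' (fun p _ => (π.symm p.2, π.symm p.1)) (fun p _ => (π p.2, π p.1))
    ?_ ?_ ?_ ?_ <;> simp +contextual [valueInv]

theorem lt_adjacent_cases {m : ℕ} {i j : Fin m} (h : (i : ℕ) + 1 = j) (x y : Fin m) :
    swap i j x < swap i j y ↔ (x < y ∧ ¬ (x = i ∧ y = j)) ∨ (x = j ∧ y = i) := by
  simp only [swap_apply_def, Fin.ext_iff, Fin.lt_def]
  grind

/-- Multiplying on the right permutes positions, so recording inversions by values makes these sets
grow along covers; inversions by positions would be relabelled. -/
theorem valueInv_mul_swap {m : ℕ} {π : Perm (Fin m)} {i j : Fin m} (h : (i : ℕ) + 1 = j)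
    (hlt : π i < π j) : valueInv (π * swap i j) = insert (π i, π j) (valueInv π) := by
  ext ⟨x, y⟩
  have e (z : Fin m) : (π * swap i j).symm z = swap i j (π.symm z) := rfl
  rw [Finset.mem_insert, mem_valueInv, mem_valueInv, e, e, lt_adjacent_cases h, Prod.mk.injEq]
  obtain ⟨x, rfl⟩ := π.surjective x
  obtain ⟨y, rfl⟩ := π.surjective y
  simp only [symm_apply_apply, EmbeddingLike.apply_eq_iff_eq]
  constructor
  · rintro ⟨h₁, h₂ | h₂⟩
    · exact Or.inr ⟨h₁, h₂.1⟩
    · exact Or.inl ⟨h₂.2, h₂.1⟩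
  · rintro (⟨rfl, rfl⟩ | ⟨h₁, h₂⟩)
    · exact ⟨hlt, Or.inr ⟨rfl, rfl⟩⟩
    · refine ⟨h₁, Or.inl ⟨h₂, ?_⟩⟩
      rintro ⟨rfl, rfl⟩
      exact absurd hlt h₁.not_gt

theorem notMem_valueInv {m : ℕ} {π : Perm (Fin m)} {i j : Fin m} (h : (i : ℕ) + 1 = j) :
    (π i, π j) ∉ valueInv π := by
  rw [mem_valueInv]
  simp only [symm_apply_apply, Fin.lt_def]
  lia

theorem invNumber_mul_swap {m : ℕ} {π : Perm (Fin m)} {i j : Fin m} (h : (i : ℕ) + 1 = j)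
    (hlt : π i < π j) : invNumber (π * swap i j) = invNumber π + 1 := by
  rw [← card_valueInv, valueInv_mul_swap h hlt, Finset.card_insert_of_notMem (notMem_valueInv h),
    card_valueInv]

theorem invNumber_mul_swap_of_gt {m : ℕ} {π : Perm (Fin m)} {i j : Fin m} (h : (i : ℕ) + 1 = j)
    (hlt : π j < π i) : invNumber π = invNumber (π * swap i j) + 1 := by
  have := invNumber_mul_swap (π := π * swap i j) h (by simpa using hlt)
  simpa [mul_assoc] using this

theorem weakCover_mul_swap {m : ℕ} {π : Perm (Fin m)} {i j : Fin m} (h : (i : ℕ) + 1 = j)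
    (hlt : π i < π j) : WeakCover π (π * swap i j) :=
  ⟨i, j, h, rfl, invNumber_mul_swap h hlt⟩

theorem WeakCover.exists_lt {m : ℕ} {π σ : Perm (Fin m)} (h : WeakCover π σ) :
    ∃ i j : Fin m, (i : ℕ) + 1 = j ∧ π i < π j ∧ σ = π * swap i j := by
  obtain ⟨i, j, h, rfl, hc⟩ := h
  refine ⟨i, j, h, ?_, rfl⟩
  by_contra hlt
  have hne : π j ≠ π i := fun he => by
    have := congrArg Fin.val (π.injective he)
    lia
  have := invNumber_mul_swap_of_gt h (lt_of_le_of_ne (not_lt.1 hlt) hne)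
  lia

theorem valueInv_subset_of_weak {m : ℕ} {π σ : Perm (Fin m)}
    (h : Relation.ReflTransGen WeakCover π σ) : valueInv π ⊆ valueInv σ := by
  induction h with
  | refl => exact subset_rfl
  | tail _ hc ih =>
    obtain ⟨i, j, h, hlt, rfl⟩ := hc.exists_lt
    rw [valueInv_mul_swap h hlt]
    exact ih.trans (Finset.subset_insert _ _)

theorem lt_of_forall_adjacent {m : ℕ} {f : Fin m → ℕ} {a : ℕ}
    (hf : ∀ i j : Fin m, (i : ℕ) + 1 = j → a ≤ i → f i < f j) {x y : Fin m} (hx : a ≤ x)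
    (hxy : x < y) : f x < f y := by
  have key : ∀ d : ℕ, ∀ y : Fin m, (x : ℕ) + d + 1 = y → f x < f y := by
    intro d
    induction d with
    | zero => exact fun y hy => hf x y hy hx
    | succ d ih =>
      intro y hy
      exact (ih ⟨x + d + 1, by lia⟩ rfl).trans (hf _ _ (by simp; lia) (by simp; lia))
  rw [Fin.lt_def] at hxy
  exact key (y - x - 1) y (by lia)

/-- Remove from `σ` a descent that is not an inversion of `π`, and induct on the number of
inversions. If there is none, `π⁻¹σ` is increasing. -/
theorem weak_of_valueInv_subset {m : ℕ} {π σ : Perm (Fin m)} (h : valueInv π ⊆ valueInv σ) :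
    Relation.ReflTransGen WeakCover π σ := by
  induction hN : invNumber σ using Nat.strong_induction_on generalizing σ with
  | _ N ih =>
  by_cases hd : ∃ i j : Fin m, (i : ℕ) + 1 = j ∧ σ j < σ i ∧ (σ j, σ i) ∉ valueInv π
  · obtain ⟨i, j, hij, hlt, hn⟩ := hd
    have hlt' : (σ * swap i j) i < (σ * swap i j) j := by simpa using hlt
    have hc := weakCover_mul_swap hij hlt'
    have hv := valueInv_mul_swap hij hlt'
    have hinv := invNumber_mul_swap_of_gt hij hlt
    rw [mul_assoc, swap_mul_self, mul_one] at hc hv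
    simp only [Perm.mul_apply, swap_apply_left, swap_apply_right] at hv
    refine (ih _ (by lia) ?_ rfl).tail hc
    intro p hp
    have := h hp
    rw [hv, Finset.mem_insert] at this
    rcases this with rfl | this
    · exact absurd hp hn
    · exact this
  · push Not at hd
    have hmono : StrictMono fun x => π.symm (σ x) := by
      intro x y hxy
      refine lt_of_forall_adjacent (f := fun x => (π.symm (σ x) : ℕ)) (a := 0) ?_ (Nat.zero_le _)
        hxy
      intro i j hij _
      rw [← Fin.lt_def]
      have hne : i ≠ j := fun he => by rw [he] at hij; lia
      rcases lt_trichotomy (σ i) (σ j) with hlt | he | hlt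
      -- At an ascent of `σ` the inclusion of inversion sets is used; at a descent, the failure of
      -- `hd`.
      · by_contra hle
        have hne' : π.symm (σ j) ≠ π.symm (σ i) := by simpa using hne.symm
        have := h (mem_valueInv.2 ⟨hlt, lt_of_le_of_ne (not_lt.1 hle) hne'⟩)
        exact notMem_valueInv hij this
      · exact absurd (σ.injective he) hne
      · exact (mem_valueInv.1 (hd i j hij hlt)).2
    have := (hmono.range_inj strictMono_id).1 (by
      rw [Set.range_id]
      exact (π.symm.surjective.comp σ.surjective).range_eq)
    have e : σ = π := by
      ext x
      have := congrFun this x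
      simp only [id, Equiv.symm_apply_eq] at this
      rw [this]
    rw [e]

/-! ### Maximal chains as sequences of permutations -/

namespace MaxChain

variable {m : ℕ}

theorem sigma_zero (C : MaxChain (m + 1)) : C.sigma 0 = finRotate (m + 1) := by
  rw [sigma, List.drop_zero, C.word_prod]

theorem sigma_of_le (C : MaxChain (m + 1)) {s : ℕ} (hs : m ≤ s) : C.sigma s = 1 := by
  rw [sigma, List.drop_of_length_le (by simpa using hs), List.prod_nil]

theorem sigma_eq_word_mul (C : MaxChain (m + 1)) (j : Fin m) :
    C.sigma j = C.word j * C.sigma (j + 1) := by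
  rw [sigma, sigma, List.drop_eq_getElem_cons (by simp), List.prod_cons, List.getElem_ofFn]

/-- Prefix and suffix products determine each other, so chains can be compared through `sigma`
alone. -/
theorem elt_mul_sigma (C : MaxChain (m + 1)) (k : Fin (m + 1)) :
    (C.elt k).1 * C.sigma k = finRotate (m + 1) := by
  obtain ⟨k, hk⟩ := k
  induction k with
  | zero =>
    have h := (C.elt_spec ⟨0, hk⟩).2
    rw [eq_one_of_absLength h, one_mul, sigma_zero]
  | succ k ih =>
    have h := ih (by lia)
    have h' := C.sigma_eq_word_mul ⟨k, by lia⟩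
    simp only at h' h
    rw [h', word, ← mul_assoc, mul_assoc] at h
    rw [← h]
    simp [Fin.castSucc, Fin.succ, mul_assoc]

theorem elt_eq_iff {C D : MaxChain (m + 1)} (k : Fin (m + 1)) :
    C.elt k = D.elt k ↔ C.sigma k = D.sigma k := by
  have h₁ := C.elt_mul_sigma k
  have h₂ := D.elt_mul_sigma k
  rw [← h₂] at h₁
  constructor
  · intro h
    rw [h] at h₁
    exact mul_left_cancel h₁
  · intro h
    rw [h] at h₁
    exact NC.ext (mul_right_cancel h₁)

theorem mem_elems_iff (C : MaxChain (m + 1)) {x : NC (m + 1)} :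
    x ∈ C.elems ↔ ∃ k, C.elt k = x := by
  constructor
  · intro hx
    have hxm : absLength x.1 ≤ m := by
      have := x.property
      rw [absLength_finRotate m] at this
      lia
    exact ⟨⟨absLength x.1, by lia⟩,
      (C.existsUnique_rank ⟨absLength x.1, by lia⟩).unique (C.elt_spec _) ⟨hx, rfl⟩⟩
  · rintro ⟨k, rfl⟩
    exact (C.elt_spec k).1

theorem elt_inj {C D : MaxChain (m + 1)} {k l : Fin (m + 1)} (h : C.elt k = D.elt l) : k = l := by
  have h₁ := (C.elt_spec k).2
  rw [h, (D.elt_spec l).2] at h₁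
  exact Fin.ext h₁.symm

theorem ext_sigma {C D : MaxChain (m + 1)} (h : ∀ s, C.sigma s = D.sigma s) : C = D := by
  have : C.elems = D.elems := by
    ext x
    simp only [mem_elems_iff, (elt_eq_iff (C := C) (D := D) _).2 (h _)]
  exact Flag.ext this

theorem elems_diff (C D : MaxChain (m + 1)) :
    C.elems \ D.elems = C.elt '' {k : Fin (m + 1) | C.sigma k ≠ D.sigma k} := by
  ext x
  simp only [Set.mem_sdiff, mem_elems_iff, Set.mem_image, Set.mem_ofPred_eq, ne_eq, ← elt_eq_iff]
  constructor
  · rintro ⟨⟨k, rfl⟩, hk⟩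
    exact ⟨k, fun h => hk ⟨k, h.symm⟩, rfl⟩
  · rintro ⟨k, hk, rfl⟩
    refine ⟨⟨k, rfl⟩, ?_⟩
    rintro ⟨l, hl⟩
    obtain rfl := elt_inj hl
    exact hk hl.symm

theorem adj_iff {C D : MaxChain (m + 1)} : (hurwitzGraph (m + 1)).Adj C D ↔
    ∃ i j : Fin m, (i : ℕ) + 1 = j ∧ C.sigma j ≠ D.sigma j ∧
      ∀ s : ℕ, s ≠ j → C.sigma s = D.sigma s := by
  have hinj (C : MaxChain (m + 1)) : Function.Injective C.elt := fun _ _ => elt_inj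
  have hadj : (hurwitzGraph (m + 1)).Adj C D ↔
      (C.elems \ D.elems).ncard = 1 ∧ (D.elems \ C.elems).ncard = 1 := Iff.rfl
  have hsymm : {k : Fin (m + 1) | D.sigma k ≠ C.sigma k} =
      {k : Fin (m + 1) | C.sigma k ≠ D.sigma k} := by
    simp only [ne_comm]
  rw [hadj, elems_diff, elems_diff, Set.ncard_image_of_injective _ (hinj C),
    Set.ncard_image_of_injective _ (hinj D), hsymm, and_self, Set.ncard_eq_one]
  constructor
  · rintro ⟨k, hk⟩
    have hk₁ : C.sigma k ≠ D.sigma k := by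
      have : k ∈ {k : Fin (m + 1) | C.sigma k ≠ D.sigma k} := by rw [hk]; rfl
      exact this
    -- All chains share `sigma 0 = c` and `sigma m = 1`, so the changed index is interior and has a
    -- predecessor in `Fin m`.
    have h₀ : (k : ℕ) ≠ 0 := fun h => hk₁ (by rw [h, sigma_zero, sigma_zero])
    have hm : ¬ m ≤ k := fun h => hk₁ (by rw [sigma_of_le _ h, sigma_of_le _ h])
    refine ⟨⟨k - 1, by lia⟩, ⟨k, by lia⟩, by simp; lia, hk₁, fun s hs => ?_⟩
    by_contra hne
    rcases le_or_gt m s with hsm | hsm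
    · exact hne (by rw [sigma_of_le _ hsm, sigma_of_le _ hsm])
    · have : (⟨s, by lia⟩ : Fin (m + 1)) ∈ {k : Fin (m + 1) | C.sigma k ≠ D.sigma k} := hne
      rw [hk] at this
      exact hs (congrArg Fin.val this)
  · rintro ⟨i, j, -, hj, hs⟩
    refine ⟨j.castSucc, ?_⟩
    ext k
    simp only [Set.mem_ofPred_eq, Set.mem_singleton_iff]
    constructor
    · intro h
      by_contra hne
      exact h (hs k fun he => hne (Fin.ext he))
    · rintro rfl
      exact hj

theorem sigma_ofWord (t : Fin m → Perm (Fin (m + 1))) (ht : ∀ i, (t i).IsSwap)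
    (hp : (List.ofFn t).prod = finRotate (m + 1)) {s : ℕ} (hs : s ≤ m) :
    (ofWord t ht hp).sigma s = ((List.ofFn t).drop s).prod := by
  have h₁ := (ofWord t ht hp).elt_mul_sigma ⟨s, by lia⟩
  have h₂ : (ofWord t ht hp).elt ⟨s, by lia⟩ = ⟨_, take_mem_NC ht hp s hs⟩ := by
    refine ((ofWord t ht hp).existsUnique_rank ⟨s, by lia⟩).unique (elt_spec _ _) ⟨?_, ?_⟩
    · exact ⟨s, hs, rfl⟩
    · exact absLength_take ht hp s hs
  rw [h₂] at h₁
  have h₃ : ((List.ofFn t).take s).prod * ((List.ofFn t).drop s).prod = finRotate (m + 1) := by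
    rw [← List.prod_append, List.take_append_drop, hp]
  exact mul_left_cancel (h₁.trans h₃.symm)

theorem exists_of_sigma (f : ℕ → Perm (Fin (m + 1))) (h₀ : f 0 = finRotate (m + 1))
    (hm : f m = 1) (hs : ∀ j < m, (f j * (f (j + 1))⁻¹).IsSwap) :
    ∃ C : MaxChain (m + 1), ∀ s ≤ m, C.sigma s = f s := by
  set t : Fin m → Perm (Fin (m + 1)) := fun j => f j * (f (j + 1))⁻¹ with ht
  have key : ∀ d s, s + d = m → ((List.ofFn t).drop s).prod = f s := by
    intro d
    induction d with
    | zero =>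
      intro s hs
      rw [List.drop_of_length_le (by simp; lia), List.prod_nil, show s = m by lia, hm]
    | succ d ih =>
      intro s hs
      rw [List.drop_eq_getElem_cons (by simp; lia), List.prod_cons, ih (s + 1) (by lia),
        List.getElem_ofFn]
      simp [ht]
  have hp : (List.ofFn t).prod = finRotate (m + 1) := by
    rw [← h₀, ← key m 0 (by simp), List.drop_zero]
  refine ⟨ofWord t (fun i => hs i i.2) hp, fun s hs => ?_⟩
  rw [sigma_ofWord _ _ _ hs, key (m - s) s (by lia)]

/-! ### Trajectories of labels -/

theorem sigma_lt (C : MaxChain (m + 1)) (j : Fin m) :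
    C.sigma (j + 1) (C.phi j).castSucc < C.sigma j (C.phi j).castSucc :=
  (C.phi_apply_eq_iff j _).1 rfl

theorem phi_eq_of_lt {C : MaxChain (m + 1)} {j i : Fin m}
    (h : C.sigma (j + 1) i.castSucc < C.sigma j i.castSucc) : C.phi j = i :=
  (C.phi_apply_eq_iff j i).2 h

/-- Reading `s` downwards from `m`, the image of the label `phi j` starts at the label itself and
rises only at step `j`; before that it can only fall. -/
theorem sigma_le (C : MaxChain (m + 1)) (j : Fin m) {s : ℕ} (hs : (j : ℕ) < s) :
    (C.sigma s (C.phi j).castSucc : ℕ) ≤ C.phi j := by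
  rcases le_or_gt m s with hsm | hsm
  · rw [sigma_of_le _ hsm]; simp
  have key : ∀ d s : ℕ, s + d = m → (j : ℕ) + 1 ≤ s →
      (C.sigma s (C.phi j).castSucc : ℕ) ≤ C.phi j := by
    intro d
    induction d with
    | zero => intro s hs _; rw [sigma_of_le _ (by lia)]; simp
    | succ d ih =>
      intro s hs hj
      have h₁ := ih (s + 1) (by lia) (by lia)
      by_contra hlt
      have := phi_eq_of_lt (C := C) (j := ⟨s, by lia⟩) (i := C.phi j) (by
        rw [Fin.lt_def]; simp only; lia)
      have := congrArg Fin.val (C.phi.injective this)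
      simp only at this
      lia
  exact key (m - s) _ (by lia) hs

/-- At `s = 0` the label is sent to its successor by `c`; increasing `s` up to `j` cannot lower the
image, since only step `j` is a rise. -/
theorem lt_sigma (C : MaxChain (m + 1)) (j : Fin m) {s : ℕ} (hs : s ≤ (j : ℕ)) :
    (C.phi j : ℕ) < C.sigma s (C.phi j).castSucc := by
  induction s with
  | zero =>
    rw [sigma_zero]
    exact castSucc_lt_finRotate (C.phi j)
  | succ s ih =>
    have h₁ := ih (by lia)
    by_contra hlt
    have := phi_eq_of_lt (C := C) (j := ⟨s, by lia⟩) (i := C.phi j) (by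
      rw [Fin.lt_def]; simp only; lia)
    have := congrArg Fin.val (C.phi.injective this)
    simp only at this
    lia

theorem eq_swap_of_isSwap {α : Type*} [DecidableEq α] {t : Perm α} (ht : t.IsSwap) {x : α}
    (hx : t x ≠ x) : t = swap x (t x) := by
  obtain ⟨a, b, -, rfl⟩ := ht
  rcases swap_apply_ne_self_iff.1 hx with ⟨-, rfl | rfl⟩
  · simp
  · simp [swap_comm]

theorem word_eq_swap (C : MaxChain (m + 1)) (j : Fin m) :
    C.word j = swap (C.sigma (j + 1) (C.phi j).castSucc) (C.sigma j (C.phi j).castSucc) := by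
  have h := C.sigma_lt j
  rw [sigma_eq_word_mul, Perm.mul_apply] at h ⊢
  exact eq_swap_of_isSwap (C.word_isSwap j) h.ne'

theorem sigma_eq_swap_mul (C : MaxChain (m + 1)) (j : Fin m) :
    C.sigma j = swap (C.sigma (j + 1) (C.phi j).castSucc) (C.sigma j (C.phi j).castSucc) *
      C.sigma (j + 1) := by
  rw [← word_eq_swap, ← sigma_eq_word_mul]

/-- Step `l` exchanges an entry `≤ phi l` with a larger one, while the image of `phi j` stays above
`phi j > phi l`. It is not the lower entry, and it is not the upper one either, since it would be
moved too low. -/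
theorem sigma_apply_eq_of_lt (C : MaxChain (m + 1)) (j : Fin m) {k : ℕ} (hk : k ≤ (j : ℕ))
    (h : ∀ l : Fin m, k ≤ (l : ℕ) → l < j → C.phi l < C.phi j) :
    C.sigma k (C.phi j).castSucc = C.sigma j (C.phi j).castSucc := by
  have key : ∀ d k : ℕ, k + d = j → (∀ l : Fin m, k ≤ (l : ℕ) → l < j → C.phi l < C.phi j) →
      C.sigma k (C.phi j).castSucc = C.sigma j (C.phi j).castSucc := by
    intro d
    induction d with
    | zero => intro k hk _; rw [show k = j by lia]
    | succ d ih =>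
      intro k hk h
      rw [← ih (k + 1) (by lia) fun l hl => h l (by lia)]
      let l : Fin m := ⟨k, by lia⟩
      have hl := h l le_rfl (by simp only [l, Fin.lt_def]; lia)
      have h₁ := C.sigma_eq_swap_mul l
      have h₂ := C.sigma_le l (Nat.lt_succ_self _)
      have h₃ := C.lt_sigma j (s := k) (by lia)
      have h₄ := C.lt_sigma j (s := k + 1) (by lia)
      have h₅ := congrArg (fun f => f (C.phi j).castSucc) h₁
      simp only [l, Perm.mul_apply] at h₅ h₂ hl
      rw [Fin.lt_def] at hl
      set x := C.sigma (k + 1) (C.phi ⟨k, by lia⟩).castSucc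
      by_cases hx : C.sigma (k + 1) (C.phi j).castSucc = x
      · rw [hx] at h₄; lia
      by_cases hy : C.sigma (k + 1) (C.phi j).castSucc = C.sigma k (C.phi ⟨k, by lia⟩).castSucc
      · rw [hy, swap_apply_right] at h₅
        rw [h₅] at h₃; lia
      rw [swap_apply_of_ne_of_ne hx hy] at h₅
      exact h₅
  exact key (j - k) k (by lia) h

/-- The uniqueness result behind all later identifications of chains. At the largest index `s` of
disagreement, the transposition of step `s` is determined by where `sigma s` sends `phi s`. -/
theorem ext_of_ascent {C D : MaxChain (m + 1)} (hphi : C.phi = D.phi)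
    (h : ∀ j : Fin m, 0 < (j : ℕ) → C.sigma j ≠ D.sigma j →
      ∃ i : Fin m, (i : ℕ) + 1 = j ∧ C.phi i < C.phi j) : C = D := by
  have key : ∀ d s, s + d = m → C.sigma s = D.sigma s := by
    intro d
    induction d with
    | zero => intro s hs; rw [sigma_of_le _ (by lia), sigma_of_le _ (by lia)]
    | succ d ih =>
      intro s hs
      have hs₁ := ih (s + 1) (by lia)
      by_contra hne
      let j : Fin m := ⟨s, by lia⟩
      -- Disagreement at `s` propagates down to index `0`, where both chains have `c`.
      have hdis : ∀ e k, k + e = s → ∀ l, k ≤ l → l ≤ s → C.sigma l ≠ D.sigma l := by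
        intro e
        induction e with
        | zero => intro k hk l hl hl'; rwa [show l = s by lia]
        | succ e ihe =>
          intro k hk l hl hl'
          have ihe' := ihe (k + 1) (by lia)
          rcases Nat.lt_or_ge k l with hkl | hkl
          · exact ihe' l hkl hl'
          obtain rfl : k = l := by lia
          intro heq
          have hasc : ∀ a b : Fin m, (a : ℕ) < b → (b : ℕ) ≤ s → k ≤ a → C.phi a < C.phi b := by
            intro a b hab hb ha
            have hstep : ∀ n : ℕ, ∀ b : Fin m, (a : ℕ) + n + 1 = b → (b : ℕ) ≤ s →
                C.phi a < C.phi b := by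
              intro n
              induction n with
              | zero =>
                intro b hb hbs
                obtain ⟨i, hi, hlt⟩ := h b (by lia) (ihe' b (by lia) hbs)
                rwa [show i = a from Fin.ext (by lia)] at hlt
              | succ n ihn =>
                intro b hb hbs
                obtain ⟨i, hi, hlt⟩ := h b (by lia) (ihe' b (by lia) hbs)
                exact (ihn i (by lia) (by lia)).trans hlt
            exact hstep (b - a - 1) b (by lia) hb
          -- Since `phi` ascends from `k` to `s`, the image of `phi s` is constant between these
          -- indices in both chains; agreement at `k` therefore carries over to `s`.
          have hC := C.sigma_apply_eq_of_lt j (k := k) (by simp only [j]; lia)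
            fun l hl hlj => hasc l j hlj le_rfl hl
          have hD := D.sigma_apply_eq_of_lt j (k := k) (by simp only [j]; lia)
            fun l hl hlj => hphi ▸ hasc l j hlj le_rfl hl
          rw [← hphi, ← heq, hC] at hD
          have e₁ := C.sigma_eq_swap_mul j
          have e₂ := D.sigma_eq_swap_mul j
          rw [← hphi, ← hD, ← hs₁] at e₂
          exact hne (e₁.trans e₂.symm)
      exact hdis s 0 (by lia) 0 le_rfl (by lia) (by rw [sigma_zero, sigma_zero])
  refine ext_sigma fun s => ?_
  rcases le_or_gt m s with hs | hs
  · rw [sigma_of_le _ hs, sigma_of_le _ hs]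
  · exact key (m - s) s (by lia)

/-! ### Flips -/

theorem phi_congr {C D : MaxChain (m + 1)} {l : Fin m} (h₁ : C.sigma l = D.sigma l)
    (h₂ : C.sigma (l + 1) = D.sigma (l + 1)) : C.phi l = D.phi l := by
  rw [phi_apply_eq_iff, h₁, h₂, ← phi_apply_eq_iff]

/-- `phi l` depends only on `sigma l` and `sigma (l + 1)`, so only its values at `i` and `j` can
change, and bijectivity leaves two possibilities. -/
theorem phi_eq_or {C D : MaxChain (m + 1)} {i j : Fin m} (hij : (i : ℕ) + 1 = j)
    (h : ∀ s : ℕ, s ≠ j → C.sigma s = D.sigma s) : D.phi = C.phi ∨ D.phi = C.phi * swap i j := by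
  have hne : i ≠ j := fun he => by rw [he] at hij; lia
  have hl (l : Fin m) (h₁ : l ≠ i) (h₂ : l ≠ j) : C.phi l = D.phi l := by
    refine phi_congr (h l fun he => h₂ (Fin.ext he)) (h _ fun he => h₁ (Fin.ext (by lia)))
  have hmem (l : Fin m) (hl' : l = i ∨ l = j) : C.phi.symm (D.phi l) = i ∨
      C.phi.symm (D.phi l) = j := by
    by_contra! hcon
    have := hl _ hcon.1 hcon.2
    rw [apply_symm_apply] at this
    have := D.phi.injective this
    rw [← this] at hcon
    tauto
  simp only [symm_apply_eq] at hmem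
  have hinj : D.phi i ≠ D.phi j := fun he => hne (D.phi.injective he)
  rcases hmem j (Or.inr rfl) with hj | hj <;> rcases hmem i (Or.inl rfl) with hi | hi
  · exact absurd (hi.trans hj.symm) hinj
  · right
    ext l
    by_cases h₁ : l = i
    · subst h₁; simp [hi]
    by_cases h₂ : l = j
    · subst h₂; simp [hj]
    simp [swap_apply_of_ne_of_ne h₁ h₂, hl l h₁ h₂]
  · left
    ext l
    by_cases h₁ : l = i
    · subst h₁; simp [hi]
    by_cases h₂ : l = j
    · subst h₂; simp [hj]
    simp [hl l h₁ h₂]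
  · exact absurd (hi.trans hj.symm) hinj

/-- The label raised second, at `swap a b a'` initially, is to be raised first in a new
factorization. The cases are the ways in which the two transpositions can overlap. -/
theorem exists_swap_factorization {α : Type*} [LinearOrder α] {a b a' b' : α} (hab : a < b)
    (hab' : a' < b') (ha : a' ≠ b) (hb : a' = a → b < b') :
    ∃ t t' : Perm α, t.IsSwap ∧ t'.IsSwap ∧ t * t' = swap a' b' * swap a b ∧
      swap a b a' < t' (swap a b a') := by
  by_cases h₁ : a' = a
  · subst h₁
    have hb := hb rfl
    refine ⟨swap a' b, swap b b', ⟨_, _, hab.ne, rfl⟩, ⟨_, _, hb.ne, rfl⟩, ?_, by simpa using hb⟩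
    ext x
    simp only [Perm.mul_apply, swap_apply_def]
    grind
  rw [swap_apply_of_ne_of_ne h₁ ha]
  by_cases h₂ : b' = b
  · subst h₂
    refine ⟨swap a' a, swap a' b', ⟨_, _, h₁, rfl⟩, ⟨_, _, hab'.ne, rfl⟩, ?_, by simpa using hab'⟩
    ext x
    simp only [Perm.mul_apply, swap_apply_def]
    grind
  by_cases h₃ : b' = a
  · subst h₃
    refine ⟨swap a' b, swap a' b', ⟨_, _, ha, rfl⟩, ⟨_, _, hab'.ne, rfl⟩, ?_, by simpa using hab'⟩
    ext x
    simp only [Perm.mul_apply, swap_apply_def]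
    grind
  · refine ⟨swap a b, swap a' b', ⟨_, _, hab.ne, rfl⟩, ⟨_, _, hab'.ne, rfl⟩, ?_,
      by simpa using hab'⟩
    ext x
    simp only [Perm.mul_apply, swap_apply_def]
    grind

theorem exists_flip (C : MaxChain (m + 1)) {i j : Fin m} (hij : (i : ℕ) + 1 = j) :
    ∃ D : MaxChain (m + 1), (∀ s : ℕ, s ≠ j → D.sigma s = C.sigma s) ∧
      D.phi = C.phi * swap i j := by
  have hne : i ≠ j := fun he => by rw [he] at hij; lia
  have hi := C.sigma_eq_swap_mul i
  have hj := C.sigma_eq_swap_mul j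
  have hilt := C.sigma_lt i
  have hjlt := C.sigma_lt j
  have hq := C.lt_sigma i le_rfl
  have hp := C.sigma_le i (s := j + 1) (by lia)
  rw [hij] at hi hilt
  set P := (C.phi j).castSucc with hP
  set Q := (C.phi i).castSucc with hQ
  have hPQ : Q ≠ P := fun he => hne (C.phi.injective (Fin.castSucc_injective _ he))
  have hQ' : swap (C.sigma (j + 1) P) (C.sigma j P) (C.sigma j Q) = C.sigma (j + 1) Q := by
    nth_rw 2 [hj]
    simp
  -- If the two lower entries coincide, then `b` is the image of `Q` under `sigma (j + 1)`; it is at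
  -- most `phi i`, which is below the image of `Q` under `sigma i`.
  obtain ⟨t, t', ht, ht', htt, hlt⟩ := exists_swap_factorization hjlt hilt
    (fun he => hPQ ((C.sigma j).injective he)) (fun he => by
      rw [he, swap_apply_left] at hQ'
      rw [hQ', Fin.lt_def]
      lia)
  rw [hQ'] at hlt
  have hprod : t * t' * C.sigma (j + 1) = C.sigma i := by
    rw [htt, mul_assoc, ← hj, ← hi]
  obtain ⟨D, hD⟩ := exists_of_sigma (Function.update C.sigma j (t' * C.sigma (j + 1)))
    (by rw [Function.update_of_ne (by lia), sigma_zero])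
    (by rw [Function.update_of_ne (by lia), sigma_of_le _ le_rfl])
    (by
      intro l hl
      by_cases h₁ : l = j
      · rw [h₁, Function.update_self, Function.update_of_ne (by lia), mul_inv_cancel_right]
        exact ht'
      by_cases h₂ : l = i
      · rw [h₂, hij, Function.update_self, Function.update_of_ne (by lia), ← hprod, mul_inv_rev,
          mul_assoc t, mul_assoc, mul_assoc, mul_inv_cancel_left, mul_inv_cancel, mul_one]
        exact ht
      · rw [Function.update_of_ne h₁, Function.update_of_ne (by lia),
          show C.sigma l = _ from C.sigma_eq_word_mul ⟨l, hl⟩, mul_inv_cancel_right]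
        exact C.word_isSwap _)
  have hoff : ∀ s : ℕ, s ≠ j → D.sigma s = C.sigma s := by
    intro s hs
    rcases le_or_gt s m with hsm | hsm
    · rw [hD s hsm, Function.update_of_ne hs]
    · rw [sigma_of_le _ hsm.le, sigma_of_le _ hsm.le]
  have hDj : D.phi j = C.phi i := by
    apply phi_eq_of_lt
    rw [hoff _ (by lia), hD j (by lia), Function.update_self]
    exact hlt
  refine ⟨D, hoff, (phi_eq_or hij fun s hs => (hoff s hs).symm).resolve_left fun he => ?_⟩
  rw [he] at hDj
  exact hne (C.phi.injective hDj.symm)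

end MaxChain

/-! ### Flips as covering relations -/

namespace MaxChain

variable {m : ℕ}

theorem phi_e (m : ℕ) : (e m).phi = 1 := by
  ext j
  have key (s : ℕ) (hs : s ≤ m) := simpleWord_drop (m - s) s (by lia) j.castSucc
  congr 1
  apply phi_eq_of_lt
  rw [Perm.one_apply, e, sigma_ofWord _ _ _ (by lia), sigma_ofWord _ _ _ (by lia), Fin.lt_def,
    key _ (by lia), key _ (by lia)]
  simp

theorem eq_e_of_phi {C : MaxChain (m + 1)} (h : C.phi = 1) : C = e m :=
  ext_of_ascent (by rw [h, phi_e]) fun j hj _ =>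
    ⟨⟨j - 1, by lia⟩, by simp only; lia, by
      rw [h, Perm.one_apply, Perm.one_apply, Fin.lt_def]; simp only; lia⟩

/-- `v` arises from `u` by changing the permutation `σ_j`, where `φ(u)` has an ascent at `i`
and `j = i + 1`, such that `φ(v)` has a descent there. -/
structure Flip (i j : Fin m) (u v : MaxChain (m + 1)) : Prop where
  succ_eq : (i : ℕ) + 1 = j
  sigma_eq : ∀ s : ℕ, s ≠ j → u.sigma s = v.sigma s
  phi_eq : v.phi = u.phi * swap i j
  lt : u.phi i < u.phi j

/-- The covering relation of the weak order on maximal chains. -/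
def Cover (u v : MaxChain (m + 1)) : Prop := ∃ i j, Flip i j u v

theorem exists_flip_below (v : MaxChain (m + 1)) {i j : Fin m} (hij : (i : ℕ) + 1 = j)
    (h : v.phi j < v.phi i) : ∃ u, Flip i j u v := by
  obtain ⟨u, hu, hphi⟩ := v.exists_flip hij
  exact ⟨u, hij, hu, by rw [hphi, mul_assoc, swap_mul_self, mul_one], by simpa [hphi] using h⟩

theorem exists_flip_above (u : MaxChain (m + 1)) {i j : Fin m} (hij : (i : ℕ) + 1 = j)
    (h : u.phi i < u.phi j) : ∃ v, Flip i j u v := by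
  obtain ⟨v, hv, hphi⟩ := u.exists_flip hij
  exact ⟨v, hij, fun s hs => (hv s hs).symm, hphi, h⟩

namespace Flip

variable {i j : Fin m} {u v : MaxChain (m + 1)}

theorem weakCover (h : Flip i j u v) : WeakCover u.phi v.phi := by
  rw [h.phi_eq]
  exact weakCover_mul_swap h.succ_eq h.lt

theorem phi_ne (h : Flip i j u v) : u.phi ≠ v.phi := fun he => by
  have := h.lt
  rw [he, h.phi_eq, Perm.mul_apply, Perm.mul_apply, swap_apply_left, swap_apply_right] at this
  exact this.not_gt h.lt

theorem invNumber_eq (h : Flip i j u v) : invNumber v.phi = invNumber u.phi + 1 := by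
  rw [h.phi_eq, invNumber_mul_swap h.succ_eq h.lt]

theorem valueInv_eq (h : Flip i j u v) :
    valueInv v.phi = insert (u.phi i, u.phi j) (valueInv u.phi) := by
  rw [h.phi_eq, valueInv_mul_swap h.succ_eq h.lt]

theorem adj (h : Flip i j u v) : (hurwitzGraph (m + 1)).Adj u v := by
  refine adj_iff.2 ⟨i, j, h.succ_eq, fun hs => h.phi_ne ?_, h.sigma_eq⟩
  congr 1
  refine ext_sigma fun s => ?_
  by_cases hsj : s = j
  · rw [hsj, hs]
  · exact h.sigma_eq s hsj

/-- The two chains can differ only at `j`, where their common `phi` ascends. -/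
theorem unique {u' : MaxChain (m + 1)} (h : Flip i j u v) (h' : Flip i j u' v) : u = u' := by
  refine ext_of_ascent (mul_right_cancel (h.phi_eq.symm.trans h'.phi_eq)) fun k _ hk => ?_
  by_cases hkj : k = j
  · subst hkj
    exact ⟨i, h.succ_eq, h.lt⟩
  · have hkj' : (k : ℕ) ≠ j := fun he => hkj (Fin.ext he)
    exact absurd ((h.sigma_eq _ hkj').trans (h'.sigma_eq _ hkj').symm) hk

end Flip

theorem adj_cases {u v : MaxChain (m + 1)} (h : (hurwitzGraph (m + 1)).Adj u v) :
    u.phi = v.phi ∨ Cover u v ∨ Cover v u := by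
  obtain ⟨i, j, hij, -, hs⟩ := adj_iff.1 h
  have hne : u.phi i ≠ u.phi j := fun he => by
    have := congrArg Fin.val (u.phi.injective he)
    lia
  rcases phi_eq_or hij hs with he | he
  · exact Or.inl he.symm
  · rcases lt_or_gt_of_ne hne with hlt | hlt
    · exact Or.inr (Or.inl ⟨i, j, hij, hs, he, hlt⟩)
    · refine Or.inr (Or.inr ⟨i, j, hij, fun s hs' => (hs s hs').symm, ?_, ?_⟩)
      · rw [he, mul_assoc, swap_mul_self, mul_one]
      · simpa [he] using hlt

/-! ### Distances in the Hurwitz graph -/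

theorem invNumber_le_of_walk {u v : MaxChain (m + 1)} (p : (hurwitzGraph (m + 1)).Walk u v) :
    invNumber v.phi ≤ invNumber u.phi + p.length := by
  induction p with
  | nil => simp
  | cons h p ih =>
    rw [SimpleGraph.Walk.length_cons]
    rcases adj_cases h with he | ⟨i, j, h⟩ | ⟨i, j, h⟩
    · rw [he]; lia
    · have := h.invNumber_eq; lia
    · have := h.invNumber_eq; lia

theorem reflTransGen_of_walk {u v : MaxChain (m + 1)} (p : (hurwitzGraph (m + 1)).Walk u v)
    (hp : invNumber v.phi = invNumber u.phi + p.length) : Relation.ReflTransGen Cover u v := by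
  induction p with
  | nil => exact .refl
  | cons h p ih =>
    have hle := invNumber_le_of_walk p
    rw [SimpleGraph.Walk.length_cons] at hp
    rcases adj_cases h with he | ⟨i, j, h⟩ | ⟨i, j, h⟩
    · rw [he] at hp; lia
    · have := h.invNumber_eq
      exact (ih (by lia)).head ⟨i, j, h⟩
    · have := h.invNumber_eq; lia

theorem exists_walk_of_reflTransGen {u v : MaxChain (m + 1)}
    (h : Relation.ReflTransGen Cover u v) :
    ∃ p : (hurwitzGraph (m + 1)).Walk u v, invNumber v.phi = invNumber u.phi + p.length := by
  induction h with
  | refl => exact ⟨.nil, rfl⟩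
  | tail _ h ih =>
    obtain ⟨p, hp⟩ := ih
    obtain ⟨i, j, h⟩ := h
    have := h.invNumber_eq
    exact ⟨p.concat h.adj, by rw [SimpleGraph.Walk.length_concat]; lia⟩

theorem weak_of_reflTransGen {u v : MaxChain (m + 1)} (h : Relation.ReflTransGen Cover u v) :
    Relation.ReflTransGen WeakCover u.phi v.phi :=
  h.lift phi fun _ _ ⟨_, _, h⟩ => h.weakCover

/-- Descents of `phi` can be flipped away one at a time, so weak-order chains lift downwards from
`v`. -/
theorem exists_reflTransGen {π : Perm (Fin m)} (v : MaxChain (m + 1))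
    (h : Relation.ReflTransGen WeakCover π v.phi) :
    ∃ u, Relation.ReflTransGen Cover u v ∧ u.phi = π := by
  induction h using Relation.ReflTransGen.head_induction_on with
  | refl => exact ⟨v, .refl, rfl⟩
  | head h _ ih =>
    obtain ⟨w, hw, rfl⟩ := ih
    obtain ⟨i, j, hij, hlt, he⟩ := h.exists_lt
    obtain ⟨u, hu⟩ := w.exists_flip_below hij (by simpa [he] using hlt)
    exact ⟨u, hw.head ⟨i, j, hu⟩, mul_right_cancel (hu.phi_eq.symm.trans he)⟩

theorem valueInv_one : valueInv (1 : Perm (Fin m)) = ∅ := by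
  ext ⟨x, y⟩
  simp only [Finset.notMem_empty, iff_false]
  exact fun h => (mem_valueInv.1 h).1.not_gt (mem_valueInv.1 h).2

theorem e_reflTransGen (v : MaxChain (m + 1)) : Relation.ReflTransGen Cover (e m) v := by
  obtain ⟨u, hu, he⟩ := v.exists_reflTransGen (π := 1)
    (weak_of_valueInv_subset (by simp [valueInv_one]))
  rwa [← eq_e_of_phi he]

theorem invNumber_phi_e : invNumber (e m).phi = 0 := by
  rw [phi_e, ← card_valueInv, valueInv_one, Finset.card_empty]

theorem dist_e (v : MaxChain (m + 1)) :
    (hurwitzGraph (m + 1)).dist (e m) v = invNumber v.phi := by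
  obtain ⟨p, hp⟩ := exists_walk_of_reflTransGen (e_reflTransGen v)
  obtain ⟨q, hq⟩ := p.reachable.exists_walk_length_eq_dist
  have h₁ := SimpleGraph.dist_le p
  have h₂ := invNumber_le_of_walk q
  rw [invNumber_phi_e] at hp h₂
  lia

theorem le_iff {u v : MaxChain (m + 1)} : u ≤ v ↔ Relation.ReflTransGen Cover u v := by
  classical
  constructor
  · rintro ⟨p, hp, hu⟩
    -- Each edge gains at most one inversion and the total gain equals the length, so every edge
    -- after `u` must be an upward flip.
    have h₁ := invNumber_le_of_walk (p.takeUntil u hu)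
    have h₂ := invNumber_le_of_walk (p.dropUntil u hu)
    have h₃ := congrArg SimpleGraph.Walk.length (p.take_spec hu)
    rw [SimpleGraph.Walk.length_append] at h₃
    rw [dist_e] at hp
    rw [invNumber_phi_e] at h₁
    exact reflTransGen_of_walk (p.dropUntil u hu) (by lia)
  · intro h
    obtain ⟨p, hp⟩ := exists_walk_of_reflTransGen (e_reflTransGen u)
    obtain ⟨q, hq⟩ := exists_walk_of_reflTransGen h
    refine ⟨p.append q, ?_, ?_⟩
    · rw [SimpleGraph.Walk.length_append, dist_e, hq, hp, invNumber_phi_e]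
      lia
    · rw [SimpleGraph.Walk.mem_support_append_iff]
      exact Or.inl p.end_mem_support

theorem eq_of_reflTransGen {u v : MaxChain (m + 1)} (h : Relation.ReflTransGen Cover u v)
    (hle : invNumber v.phi ≤ invNumber u.phi) : u = v := by
  obtain ⟨p, hp⟩ := exists_walk_of_reflTransGen h
  exact SimpleGraph.Walk.eq_of_length_eq_zero (p := p) (by lia)

/-! ### Injectivity of `φ` on intervals -/

/-- The last clause says that `phi x` lies above every common lower bound of the two images.
Overlapping positions give a hexagon, disjoint ones a square. -/
theorem exists_meet_of_lt {v v₁ v₂ : MaxChain (m + 1)} {i j k l : Fin m} (h₁ : Flip i j v₁ v)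
    (h₂ : Flip k l v₂ v) (hik : i < k) :
    ∃ x, Relation.ReflTransGen Cover x v₁ ∧ Relation.ReflTransGen Cover x v₂ ∧
      ∀ π : Perm (Fin m), valueInv π ⊆ valueInv v₁.phi → valueInv π ⊆ valueInv v₂.phi →
        valueInv π ⊆ valueInv x.phi := by
  have hij := h₁.succ_eq
  have hkl := h₂.succ_eq
  rw [Fin.lt_def] at hik
  have e₁ : v₁.phi = v.phi * swap i j := by
    rw [h₁.phi_eq, mul_assoc, swap_mul_self, mul_one]
  have e₂ : v₂.phi = v.phi * swap k l := by
    rw [h₂.phi_eq, mul_assoc, swap_mul_self, mul_one]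
  have l₁ := h₁.lt
  have l₂ := h₂.lt
  have n₁ := notMem_valueInv (π := v₁.phi) hij
  have n₂ := notMem_valueInv (π := v₂.phi) hkl
  have hij' : i ≠ j := fun h => by rw [h] at hij; lia
  have hkl' : k ≠ l := fun h => by rw [h] at hkl; lia
  have hil : i ≠ l := fun h => by rw [h] at hik; lia
  have hik' : i ≠ k := fun h => by rw [h] at hik; lia
  have hjl : j ≠ l := fun h => by rw [h] at hij; lia
  by_cases hjk : j = k
  · subst hjk
    have a₁ : v₁.phi i = v.phi j := by simp [e₁]
    have a₂ : v₁.phi j = v.phi i := by simp [e₁]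
    have a₃ : v₁.phi l = v.phi l := by simp [e₁, swap_apply_of_ne_of_ne hil.symm hkl'.symm]
    have b₁ : v₂.phi i = v.phi i := by simp [e₂, swap_apply_of_ne_of_ne hij' hil]
    have b₂ : v₂.phi j = v.phi l := by simp [e₂]
    have b₃ : v₂.phi l = v.phi j := by simp [e₂]
    rw [a₁, a₂] at l₁ n₁
    rw [b₂, b₃] at l₂ n₂
    obtain ⟨x₁, hx₁⟩ := v₁.exists_flip_below hkl (by rw [a₂, a₃]; exact l₂.trans l₁)
    have f₁ : x₁.phi = v₁.phi * swap j l := by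
      rw [hx₁.phi_eq, mul_assoc, swap_mul_self, mul_one]
    have c₁ : x₁.phi i = v.phi j := by simp [f₁, swap_apply_of_ne_of_ne hij' hil, a₁]
    have c₂ : x₁.phi j = v.phi l := by simp [f₁, a₃]
    have c₃ : x₁.phi l = v.phi i := by simp [f₁, a₂]
    obtain ⟨x₂, hx₂⟩ := v₂.exists_flip_below hij (by rw [b₁, b₂]; exact l₂.trans l₁)
    have f₂ : x₂.phi = v₂.phi * swap i j := by
      rw [hx₂.phi_eq, mul_assoc, swap_mul_self, mul_one]
    have d₁ : x₂.phi i = v.phi l := by simp [f₂, b₂]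
    have d₂ : x₂.phi j = v.phi i := by simp [f₂, b₁]
    have d₃ : x₂.phi l = v.phi j := by
      simp [f₂, swap_apply_of_ne_of_ne hil.symm hkl'.symm, b₃]
    obtain ⟨x, hx⟩ := x₁.exists_flip_below hij (by rw [c₁, c₂]; exact l₂)
    obtain ⟨y, hy⟩ := x₂.exists_flip_below hkl (by rw [d₂, d₃]; exact l₁)
    have g₁ : x.phi = x₁.phi * swap i j := by
      rw [hx.phi_eq, mul_assoc, swap_mul_self, mul_one]
    have g₂ : y.phi = x₂.phi * swap j l := by
      rw [hy.phi_eq, mul_assoc, swap_mul_self, mul_one]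
    have p₁ : x.phi i = v.phi l := by simp [g₁, c₂]
    have p₂ : x.phi j = v.phi j := by simp [g₁, c₁]
    have p₃ : x.phi l = v.phi i := by
      simp [g₁, swap_apply_of_ne_of_ne hil.symm hkl'.symm, c₃]
    -- The two sides of the hexagon end at the same `phi`, which ascends at both flipped places, so
    -- rigidity closes it.
    have hxy : x = y := by
      refine ext_of_ascent ?_ fun s _ hs => ?_
      · rw [g₁, g₂, f₁, f₂, e₁, e₂]
        ext z
        simp only [Perm.mul_apply, swap_apply_def]
        grind
      · by_cases hsj : s = j
        · subst hsj
          exact ⟨i, hij, by rw [p₁, p₂]; exact l₂⟩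
        by_cases hsl : s = l
        · subst hsl
          exact ⟨j, hkl, by rw [p₂, p₃]; exact l₁⟩
        have hsj' : (s : ℕ) ≠ j := fun h => hsj (Fin.ext h)
        have hsl' : (s : ℕ) ≠ l := fun h => hsl (Fin.ext h)
        refine absurd ?_ hs
        rw [hx.sigma_eq _ hsj', hx₁.sigma_eq _ hsl', h₁.sigma_eq _ hsj', hy.sigma_eq _ hsl',
          hx₂.sigma_eq _ hsj', h₂.sigma_eq _ hsl']
    refine ⟨x, .head ⟨i, j, hx⟩ (.single ⟨j, l, hx₁⟩), ?_, ?_⟩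
    · rw [hxy]
      exact .head ⟨j, l, hy⟩ (.single ⟨i, j, hx₂⟩)
    · intro π hπ₁ hπ₂ ⟨r, s⟩ hp
      have hq := hπ₁ hp
      rw [hx₁.valueInv_eq, hx.valueInv_eq, p₁, p₂, c₂, c₃, Finset.mem_insert,
        Finset.mem_insert] at hq
      rcases hq with he | he | hq
      -- Excluding `n₁` and `n₂` orders the positions of the three values in `π`, so by transitivity
      -- the outer two are not inverted.
      · exfalso
        obtain ⟨rfl, rfl⟩ := Prod.mk.inj he
        have m₁ : ¬ (π.symm (v.phi i) < π.symm (v.phi j)) := fun h =>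
          n₁ (hπ₁ (mem_valueInv.2 ⟨l₁, h⟩))
        have m₂ : ¬ (π.symm (v.phi j) < π.symm (v.phi l)) := fun h =>
          n₂ (hπ₂ (mem_valueInv.2 ⟨l₂, h⟩))
        have := (mem_valueInv.1 hp).2
        exact absurd (this.trans_le ((not_lt.1 m₂).trans (not_lt.1 m₁))) (lt_irrefl _)
      · rw [he] at hp
        exact absurd (hπ₂ hp) n₂
      · exact hq
  · have hjk' : (j : ℕ) ≠ k := fun h => hjk (Fin.ext h)
    have a₁ : v₁.phi k = v.phi k := by
      simp [e₁, swap_apply_of_ne_of_ne hik'.symm (Ne.symm hjk)]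
    have a₂ : v₁.phi l = v.phi l := by simp [e₁, swap_apply_of_ne_of_ne hil.symm hjl.symm]
    have b₁ : v₂.phi i = v.phi i := by simp [e₂, swap_apply_of_ne_of_ne hik' hil]
    have b₂ : v₂.phi j = v.phi j := by simp [e₂, swap_apply_of_ne_of_ne hjk hjl]
    have b₃ : v₂.phi k = v.phi l := by simp [e₂]
    have b₄ : v₂.phi l = v.phi k := by simp [e₂]
    have a₃ : v₁.phi i = v.phi j := by simp [e₁]
    have a₄ : v₁.phi j = v.phi i := by simp [e₁]
    rw [a₃, a₄] at l₁
    rw [b₃, b₄] at l₂ n₂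
    obtain ⟨x, hx⟩ := v₁.exists_flip_below hkl (by rw [a₁, a₂]; exact l₂)
    obtain ⟨y, hy⟩ := v₂.exists_flip_below hij (by rw [b₁, b₂]; exact l₁)
    have g₁ : x.phi = v₁.phi * swap k l := by
      rw [hx.phi_eq, mul_assoc, swap_mul_self, mul_one]
    have g₂ : y.phi = v₂.phi * swap i j := by
      rw [hy.phi_eq, mul_assoc, swap_mul_self, mul_one]
    have hphi : x.phi = y.phi := by
      rw [g₁, g₂, e₁, e₂]
      ext z
      simp only [Perm.mul_apply, swap_apply_def]
      grind
    have hxy : x = y := by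
      refine ext_of_ascent hphi fun s _ hs => ?_
      by_cases hsj : s = j
      · subst hsj
        exact ⟨i, hij, by rw [hphi]; exact hy.lt⟩
      by_cases hsl : s = l
      · subst hsl
        exact ⟨k, hkl, hx.lt⟩
      have hsj' : (s : ℕ) ≠ j := fun h => hsj (Fin.ext h)
      have hsl' : (s : ℕ) ≠ l := fun h => hsl (Fin.ext h)
      refine absurd ?_ hs
      rw [hx.sigma_eq _ hsl', h₁.sigma_eq _ hsj', hy.sigma_eq _ hsj', h₂.sigma_eq _ hsl']
    refine ⟨x, .single ⟨k, l, hx⟩, ?_, ?_⟩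
    · rw [hxy]
      exact .single ⟨i, j, hy⟩
    · intro π hπ₁ hπ₂ p hp
      have hq := hπ₁ hp
      have p₁ : x.phi k = v.phi l := by simp [g₁, a₂]
      have p₂ : x.phi l = v.phi k := by simp [g₁, a₁]
      rw [hx.valueInv_eq, Finset.mem_insert, p₁, p₂] at hq
      rcases hq with rfl | hq
      · exact absurd (hπ₂ hp) n₂
      · exact hq

theorem exists_meet {v v₁ v₂ : MaxChain (m + 1)} (h₁ : Cover v₁ v) (h₂ : Cover v₂ v) :
    ∃ x, Relation.ReflTransGen Cover x v₁ ∧ Relation.ReflTransGen Cover x v₂ ∧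
      ∀ π : Perm (Fin m), valueInv π ⊆ valueInv v₁.phi → valueInv π ⊆ valueInv v₂.phi →
        valueInv π ⊆ valueInv x.phi := by
  obtain ⟨i, j, h₁⟩ := h₁
  obtain ⟨k, l, h₂⟩ := h₂
  rcases lt_trichotomy i k with h | rfl | h
  · exact exists_meet_of_lt h₁ h₂ h
  · obtain rfl : j = l := Fin.ext (h₁.succ_eq.symm.trans h₂.succ_eq)
    obtain rfl := h₁.unique h₂
    exact ⟨v₁, .refl, .refl, fun _ h _ => h⟩
  · obtain ⟨x, hx₂, hx₁, hx⟩ := exists_meet_of_lt h₂ h₁ h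
    exact ⟨x, hx₁, hx₂, fun π h h' => hx π h' h⟩

/-- Diamond-lemma induction: a lift `w` of the common image below the bound `x` equals `u` by
induction below `v₁`, and `u'` by induction below `v₂`. -/
theorem eq_of_phi_eq {u u' v : MaxChain (m + 1)} (h : Relation.ReflTransGen Cover u v)
    (h' : Relation.ReflTransGen Cover u' v) (hphi : u.phi = u'.phi) : u = u' := by
  induction hN : invNumber v.phi using Nat.strong_induction_on generalizing u u' v with
  | _ N ih =>
  rcases h.cases_tail with rfl | ⟨v₁, hu, h₁⟩
  · exact (eq_of_reflTransGen h' (by rw [hphi])).symm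
  rcases h'.cases_tail with rfl | ⟨v₂, hu', h₂⟩
  · exact eq_of_reflTransGen h (by rw [hphi])
  obtain ⟨x, hx₁, hx₂, hx⟩ := exists_meet h₁ h₂
  obtain ⟨w, hw, hwphi⟩ := x.exists_reflTransGen (weak_of_valueInv_subset (hx u.phi
    (valueInv_subset_of_weak (weak_of_reflTransGen hu))
    (hphi ▸ valueInv_subset_of_weak (weak_of_reflTransGen hu'))))
  obtain ⟨_, _, h₁⟩ := h₁
  obtain ⟨_, _, h₂⟩ := h₂
  have i₁ := h₁.invNumber_eq
  have i₂ := h₂.invNumber_eq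
  exact (ih _ (by lia) hu (hw.trans hx₁) hwphi.symm rfl).trans
    (ih _ (by lia) (hw.trans hx₂) hu' (hwphi.trans hphi) rfl)

theorem valueInv_subset_of_isMax {w : MaxChain (m + 1)} (hw : IsMax w) (π : Perm (Fin m)) :
    valueInv π ⊆ valueInv w.phi := by
  -- An ascent would allow an upward flip, so `phi` decreases; subtracting from `m` turns this into
  -- an increasing function.
  have hanti : ∀ i j : Fin m, (i : ℕ) + 1 = j → 0 ≤ (i : ℕ) →
      m - (w.phi i : ℕ) < m - (w.phi j : ℕ) := by
    intro i j hij _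
    by_contra hle
    have hne : w.phi i ≠ w.phi j := fun he => by
      have := congrArg Fin.val (w.phi.injective he)
      lia
    obtain ⟨v, hv⟩ := w.exists_flip_above hij (lt_of_le_of_ne (by rw [Fin.le_def]; lia) hne)
    have hle := hw (le_iff.2 (.single ⟨i, j, hv⟩))
    obtain ⟨p, hp⟩ := exists_walk_of_reflTransGen (le_iff.1 hle)
    have := hv.invNumber_eq
    lia
  rintro ⟨x, y⟩ hxy
  rw [mem_valueInv] at hxy ⊢
  refine ⟨hxy.1, ?_⟩
  by_contra hle
  have hne : w.phi.symm x ≠ w.phi.symm y := fun he => hxy.1.ne (w.phi.symm.injective he)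
  have := lt_of_forall_adjacent hanti (Nat.zero_le _) (lt_of_le_of_ne (not_lt.1 hle) hne)
  simp only [apply_symm_apply] at this
  have := hxy.1
  rw [Fin.lt_def] at this
  lia

end MaxChain

/-! ### The isomorphism on maximal intervals -/

theorem theoremt (m : ℕ) :
    IsPartialOrder (MaxChain (m + 1)) (· ≤ ·) ∧
    (∀ w : MaxChain (m + 1), MaxChain.e m ≤ w) ∧
    ∀ w₀ : MaxChain (m + 1), IsMax w₀ →
      ∃ f : {w : MaxChain (m + 1) // MaxChain.e m ≤ w ∧ w ≤ w₀} ≃o WeakPerm m,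
        ∀ w, f w = WeakPerm.of (MaxChain.phi w.1) := by
  have he (w : MaxChain (m + 1)) : MaxChain.e m ≤ w :=
    MaxChain.le_iff.2 (MaxChain.e_reflTransGen w)
  refine ⟨{ refl := fun u => MaxChain.le_iff.2 .refl
            trans := fun u v w h₁ h₂ =>
              MaxChain.le_iff.2 ((MaxChain.le_iff.1 h₁).trans (MaxChain.le_iff.1 h₂))
            antisymm := fun u v h₁ h₂ => ?_ }, he, fun w₀ hw₀ => ?_⟩
  · obtain ⟨p, hp⟩ := MaxChain.exists_walk_of_reflTransGen (MaxChain.le_iff.1 h₂)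
    exact MaxChain.eq_of_reflTransGen (MaxChain.le_iff.1 h₁) (by lia)
  let F : {w : MaxChain (m + 1) // MaxChain.e m ≤ w ∧ w ≤ w₀} → WeakPerm m :=
    fun w => WeakPerm.of (MaxChain.phi w.1)
  have hF : Function.Bijective F := by
    refine ⟨fun u u' h => Subtype.ext ?_, fun π => ?_⟩
    · exact MaxChain.eq_of_phi_eq (MaxChain.le_iff.1 u.2.2) (MaxChain.le_iff.1 u'.2.2)
        (WeakPerm.of.injective h)
    · obtain ⟨u, hu, hphi⟩ := w₀.exists_reflTransGen (π := WeakPerm.of.symm π)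
        (weak_of_valueInv_subset (MaxChain.valueInv_subset_of_isMax hw₀ _))
      exact ⟨⟨u, he u, MaxChain.le_iff.2 hu⟩, (WeakPerm.of.symm_apply_eq.1 hphi.symm).symm⟩
  refine ⟨⟨Equiv.ofBijective F hF, fun {u v} => ?_⟩, fun w => rfl⟩
  change Relation.ReflTransGen WeakCover u.1.phi v.1.phi ↔ u.1 ≤ v.1
  refine ⟨fun h => ?_, fun h => MaxChain.weak_of_reflTransGen (MaxChain.le_iff.1 h)⟩
  -- To reflect the order, lift `phi u` below `v`; injectivity under `w₀` identifies the lift with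
  -- `u`.
  obtain ⟨w, hw, hphi⟩ := MaxChain.exists_reflTransGen v.1 h
  have : w = u.1 := MaxChain.eq_of_phi_eq (hw.trans (MaxChain.le_iff.1 v.2.2))
    (MaxChain.le_iff.1 u.2.2) hphi
  rw [← this]
  exact MaxChain.le_iff.2 hw
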